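/- Let $G=(V,E)$ be an infinite, connected, locally finite simple graph with all degrees $d_x\le\Delta$ for some $\Delta<\infty$, and let $d$ be the graph distance. Suppose that $G$ is non-amenable, i.e. $\kappa_V(G)=\inf\{|\partial_V K|/|K| : K\subset V \text{ finite, nonempty}\}>0$, where $\partial_V K$ is the set of vertices outside $K$ that have a neighbour in $K$. Let $p^{(n)}(x,y)$ be the probability that simple random walk on $G$ started at $x$ is at $y$ after $n$ steps, let $\rho=\limsup_{n\to\infty}p^{(n)}(x,y)^{1/n}$ be the spectral radius of $G$ (which does not depend on $x,y$), and put $$u_0=\frac{1}{2\Delta^2}\Big(\frac1\rho-1\Big).$$ For $u\ge 0$ consider the following two-type Galton–Watson tree (forest) $T$. The first generation consists of a $\mathrm{Poisson}(u\Delta^2)$ number of individuals, all of type $\circ$. Every individual has a $\mathrm{Poisson}(u\Delta^2)$ number of descendants (children) of type $\circ$; in addition, every $\circ$-individual has exactly two, and every $\bullet$-individual exactly one, descendant of type $\bullet$. All these numbers are independent. Independently of $T$, the edges $e$ of $T$ carry i.i.d. labels $\ell_e$ that are uniform on $\{1,\dots,\Delta!\}$. For every $y\in V$ fix a bijection $\phi_y$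 from $\mathbb Z/d_y\mathbb Z$ to the set of neighbours of $y$. For $x\in V$, the branching random walk $(Z^x_a)_{a\in T}$ started at $x$ is defined by $Z^x_a=x$ for $a$ in the first generation, and $Z^x_b=\phi_y(\ell_{\{a,b\}}\bmod d_y)$ if $b$ is a descendant (child) of $a$ and $Z^x_a=y$. Let $\mathbf P_u$ be the underlying probability measure. Then $u_0>0$, and for every fixed $x\in V$ and every $0\le u<u_0$, $$\lim_{y;\,d(x,y)\to\infty}\mathbf P_u\big[\exists\, a\in T : Z^x_a=y\big]=0 .$$ -/

import Mathlib

open MeasureTheory ProbabilityTheory Filter Topology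
open scoped NNReal ENNReal

namespace TwoTypeBRW

section Graph

variable {V : Type*} (G : SimpleGraph V)

/-- The outer vertex boundary of `K`: the vertices outside `K` with a neighbour in `K`. -/
def vertexBoundary (K : Set V) : Set V :=
  {y | y ∉ K ∧ ∃ x ∈ K, G.Adj x y}

/-- The vertex isoperimetric constant `κ_V(G)`, the infimum of `|∂_V K| / |K|` over the nonempty
finite sets `K` of vertices. (For a locally finite graph the boundaries are finite.) -/
noncomputable def isoperimetricConstant : ℝ :=
  ⨅ K : {K : Finset V // K.Nonempty},
    ((vertexBoundary G (K.1 : Set V)).ncard : ℝ) / (K.1.card : ℝ)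

/-- A graph is non-amenable if its vertex isoperimetric constant is positive. -/
def IsNonamenable : Prop := 0 < isoperimetricConstant G

variable [G.LocallyFinite]

open Classical in
/-- `walkProb G n x y` is `p⁽ⁿ⁾(x, y)`, the probability that the simple random walk on `G` started
at `x` (which jumps at each step to a uniformly chosen neighbour) is at `y` after `n` steps. -/
noncomputable def walkProb : ℕ → V → V → ℝ
  | 0, x, y => if x = y then 1 else 0
  | n + 1, x, y => ∑ z ∈ G.neighborFinset x, (1 / (G.degree x : ℝ)) * walkProb n z y

/-- `limsup_n (p⁽ⁿ⁾(x, y))^(1/n)`. On a connected graph this does not depend on `x` and `y`, and is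
the spectral radius `ρ(G)`. The sequence takes values in `[0, 1]`. -/
noncomputable def walkSpectralRadius (x y : V) : ℝ :=
  limsup (fun n : ℕ => walkProb G n x y ^ (1 / (n : ℝ))) atTop

end Graph

/-- The two types of individuals, `∘` and `•`. -/
inductive Kind
  | circ
  | bullet

/-- Names of potential individuals: `root i` is the `i`-th individual of the first generation, and
`child a t j` is the `j`-th descendant of type `t` of the individual `a`
(the numbering starts from `0`). -/
inductive Individual
  | root (i : ℕ)
  | child (a : Individual) (t : Kind) (j : ℕ)

/-- The type of an individual; in the first generation all individuals are of type `∘`. -/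
def Individual.kind : Individual → Kind
  | .root _ => .circ
  | .child _ t _ => t

/-- The offspring distributions: `offspringLaw r s t` is the law of the number of `t`-descendants
of an `s`-individual, where `r` is the Poisson parameter. -/
noncomputable def offspringLaw (r : ℝ≥0) : Kind → Kind → Measure ℕ
  | .circ, .bullet => Measure.dirac 2
  | .bullet, .bullet => Measure.dirac 1
  | .circ, .circ => poissonMeasure r
  | .bullet, .circ => poissonMeasure r

/-- Indices of the random variables from which the branching random walk is built: the size of the
first generation, the number of `t`-descendants of the individual `a`, and the label
of the edge that joins `a` to its descendant `child a t j`. -/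
inductive Source
  | initial
  | offspring (a : Individual) (t : Kind)
  | label (a : Individual) (t : Kind) (j : ℕ)

/-- The laws of these random variables. The size of the first generation is Poisson, the numbers of
descendants follow the offspring distributions, and the labels are uniform
on `{1, …, Δ!}`. -/
noncomputable def sourceLaw (Δ : ℕ) (r : ℝ≥0) : Source → Measure ℕ
  | .initial => poissonMeasure r
  | .offspring a t => offspringLaw r a.kind t
  | .label _ _ _ => uniformOn (Set.Icc 1 Δ.factorial)

/-- The family `X` of random variables on the probability space `(S, P)` is independent with the
prescribed laws, the Poisson parameter being `u Δ²`. -/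
structure IsDriving {S : Type*} [MeasurableSpace S] (P : Measure S) (Δ : ℕ) (u : ℝ≥0)
    (X : Source → S → ℕ) : Prop where
  measurable : ∀ i, Measurable (X i)
  law : ∀ i, P.map (X i) = sourceLaw Δ (u * (Δ : ℝ≥0) ^ 2) i
  indep : iIndepFun X P

/-- `InTree X s a` says that the potential individual `a` belongs to the two-type Galton-Watson
tree `T` at the outcome `s`. -/
def InTree {S : Type*} (X : Source → S → ℕ) (s : S) : Individual → Prop
  | .root i => i < X .initial s
  | .child a t j => InTree X s a ∧ j < X (.offspring a t) s

/-- The positions `Z_a^x` of the branching random walk started at `x`: the first generation sits at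
`x`, and a descendant of an individual at `y` sits at `φ_y(ℓ mod d_y)`, where `ℓ` is the label of
the edge joining the two. -/
def position {V : Type*} (G : SimpleGraph V) [G.LocallyFinite]
    (φ : ∀ y : V, ZMod (G.degree y) ≃ G.neighborSet y) (x : V)
    {S : Type*} (X : Source → S → ℕ) (s : S) : Individual → V
  | .root _ => x
  | .child a t j =>
      let y := position G φ x X s a
      (φ y ((X (.label a t j) s : ℕ) : ZMod (G.degree y)) : V)

/-- The event that the branching random walk started at `x` ever visits `y`,
i.e. `Z_a^x = y` for some `a` in the tree. -/
def visits {V : Type*} (G : SimpleGraph V) [G.LocallyFinite]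
    (φ : ∀ y : V, ZMod (G.degree y) ≃ G.neighborSet y) (x : V)
    {S : Type*} (X : Source → S → ℕ) (y : V) : Set S :=
  {s | ∃ a : Individual, InTree X s a ∧ position G φ x X s a = y}

/-- The threshold `u₀ = (1 / (2 Δ²)) (1 / ρ - 1)`. -/
noncomputable def threshold (Δ : ℕ) (ρ : ℝ) : ℝ :=
  1 / (2 * (Δ : ℝ) ^ 2) * (1 / ρ - 1)

end TwoTypeBRW

open TwoTypeBRW

/-! The proof is a first moment bound. Put $r=u\Delta^2$. Every degree divides $\Delta!$, so along a
fixed ancestral line the labels drive a simple random walk, and an individual of generation $n$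
contributes its probability of existing times $p^{(n)}(x,y)$. The mean offspring matrix has rows
$(r,2)$ and $(r,1)$, and the vector $(2,1)$ shows that generation masses grow at most by the factor
$1+2r$. Hence `measure_visits_le`: the visiting probability is at most
$\sum_n(1+2r)^n\,2r\,p^{(n)}(x,y)$.

For $q>\rho$, reversibility gives $p^{(n)}(x,y)\le Cq^n$ uniformly in $y$ for large $n$
(`exists_walkProb_le`), and $p^{(n)}(x,y)=0$ for $n<d(x,y)$. The condition $u<u_0$ says exactly that
$(1+2r)\rho<1$, so $q$ can be chosen with $(1+2r)q<1$, and what remains is the tail of a convergent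
geometric series, starting at $d(x,y)$.

Positivity of $u_0$ is Kesten's theorem $\rho<1$ (`walkSpectralRadius_lt_one`), obtained from
`coarea`, `cheeger` and the resulting $\ell^2$ contraction `exists_walkOp_contraction`. -/

namespace TwoTypeBRW

/-! ### Isoperimetry, Cheeger's inequality and the $\ell^2$ contraction -/

section Cheeger

variable {V : Type*} (G : SimpleGraph V)

open Classical in
/-- The indicator of adjacency, as a real number. -/
noncomputable def adjWeight (x y : V) : ℝ := if G.Adj x y then 1 else 0

lemma adjWeight_nonneg (x y : V) : 0 ≤ adjWeight G x y := by
  unfold adjWeight; split_ifs <;> norm_num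

lemma adjWeight_comm (x y : V) : adjWeight G x y = adjWeight G y x := by
  unfold adjWeight
  by_cases h : G.Adj x y
  · rw [if_pos h, if_pos h.symm]
  · rw [if_neg h, if_neg fun h' => h h'.symm]

lemma adjWeight_of_adj {x y : V} (h : G.Adj x y) : adjWeight G x y = 1 := by
  simp [adjWeight, h]

lemma adjWeight_of_not_adj {x y : V} (h : ¬ G.Adj x y) : adjWeight G x y = 0 := by
  simp [adjWeight, h]

lemma isoperimetricConstant_mul_card_le (s : Finset V) :
    isoperimetricConstant G * s.card ≤ ((vertexBoundary G (s : Set V)).ncard : ℝ) := by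
  rcases s.eq_empty_or_nonempty with rfl | hs
  · simp
  · have h : isoperimetricConstant G ≤
        ((vertexBoundary G (s : Set V)).ncard : ℝ) / (s.card : ℝ) := by
      refine ciInf_le (f := fun K : {K : Finset V // K.Nonempty} =>
        ((vertexBoundary G (K.1 : Set V)).ncard : ℝ) / (K.1.card : ℝ)) ⟨0, ?_⟩ ⟨s, hs⟩
      rintro _ ⟨K, rfl⟩
      positivity
    rwa [le_div_iff₀ (by exact_mod_cast hs.card_pos)] at h

lemma sum_adjWeight_mul_comm (K : Finset V) (F : V → V → ℝ) :
    ∑ x ∈ K, ∑ y ∈ K, adjWeight G x y * F y x = ∑ x ∈ K, ∑ y ∈ K, adjWeight G x y * F x y := by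
  rw [Finset.sum_comm]
  simp_rw [adjWeight_comm G]

-- Each boundary vertex of `s` carries at least one crossing edge, and the double sum counts every
-- crossing edge in both directions; hence the factor 2.
open Classical in
lemma isoperimetric_edge (K s : Finset V)
    (hK : ∀ x ∈ s, x ∈ K ∧ ∀ y, G.Adj x y → y ∈ K) :
    2 * isoperimetricConstant G * s.card ≤
      ∑ x ∈ K, ∑ y ∈ K, adjWeight G x y *
        |(if x ∈ s then (1 : ℝ) else 0) - (if y ∈ s then 1 else 0)| := by
  set F : V → V → ℝ := fun x y => if x ∈ s ∧ y ∉ s then 1 else 0 with hF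
  have hsplit : ∀ x y, |(if x ∈ s then (1 : ℝ) else 0) - (if y ∈ s then 1 else 0)|
      = F y x + F x y := by
    intro x y
    by_cases hx : x ∈ s <;> by_cases hy : y ∈ s <;> simp [hF, hx, hy]
  have hbd : vertexBoundary G (s : Set V) =
      ((K.filter fun y => y ∉ s ∧ ∃ x ∈ s, G.Adj x y : Finset V) : Set V) := by
    ext y
    simp only [vertexBoundary, Set.mem_ofPred_eq, Finset.coe_filter, Finset.mem_coe]
    constructor
    · rintro ⟨h1, x, hx, hxy⟩
      exact ⟨(hK x hx).2 y hxy, h1, x, hx, hxy⟩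
    · rintro ⟨-, h⟩
      exact h
  have hle : ((vertexBoundary G (s : Set V)).ncard : ℝ) ≤
      ∑ x ∈ K, ∑ y ∈ K, adjWeight G x y * F y x := by
    rw [hbd, Set.ncard_coe_finset, Finset.card_filter, Nat.cast_sum]
    refine Finset.sum_le_sum fun y hy => ?_
    have hnn : ∀ x ∈ K, 0 ≤ adjWeight G y x * F x y := fun x _ =>
      mul_nonneg (adjWeight_nonneg G _ _) (by simp only [hF]; split_ifs <;> norm_num)
    split_ifs with h
    · obtain ⟨hys, x, hx, hxy⟩ := h
      refine le_trans ?_ (Finset.single_le_sum hnn (hK x hx).1)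
      simp [hF, hx, hys, adjWeight_of_adj G hxy.symm]
    · simpa using Finset.sum_nonneg hnn
  have hiso := isoperimetricConstant_mul_card_le G s
  simp_rw [hsplit, mul_add, Finset.sum_add_distrib]
  rw [sum_adjWeight_mul_comm] at hle ⊢
  linarith

/-- The coarea inequality: the isoperimetric inequality for functions. -/
lemma coarea (K : Finset V) (n : ℕ) : ∀ h : V → ℝ, (∀ x, 0 ≤ h x) →
    (∀ x, h x ≠ 0 → x ∈ K ∧ ∀ y, G.Adj x y → y ∈ K) →
    (K.filter fun x => h x ≠ 0).card ≤ n →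
    2 * isoperimetricConstant G * ∑ x ∈ K, h x ≤
      ∑ x ∈ K, ∑ y ∈ K, adjWeight G x y * |h x - h y| := by
  classical
  induction n with
  | zero =>
    intro h _ _ hc
    have h0 : ∀ x ∈ K, h x = 0 := by
      simpa [Finset.filter_eq_empty_iff] using hc
    rw [Finset.sum_eq_zero h0, mul_zero]
    exact Finset.sum_nonneg fun x _ => Finset.sum_nonneg fun y _ =>
      mul_nonneg (adjWeight_nonneg G _ _) (abs_nonneg _)
  | succ n ih =>
    intro h hnn hK hc
    set s := K.filter fun x => h x ≠ 0 with hs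
    have hmem : ∀ x, x ∈ s ↔ h x ≠ 0 := fun x => by
      simp only [hs, Finset.mem_filter, and_iff_right_iff_imp]
      exact fun hx => (hK x hx).1
    rcases s.eq_empty_or_nonempty with hse | hse
    · have h0 : ∀ x ∈ K, h x = 0 := by
        simpa [hs, Finset.filter_eq_empty_iff] using hse
      rw [Finset.sum_eq_zero h0, mul_zero]
      exact Finset.sum_nonneg fun x _ => Finset.sum_nonneg fun y _ =>
        mul_nonneg (adjWeight_nonneg G _ _) (abs_nonneg _)
    -- Peel off the lowest layer: subtracting the minimum `m` of `h` on its support `s` kills `z`,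
    -- so the support of `h'` is strictly smaller, and the layer `m * 1_s` is handled by
    -- `isoperimetric_edge`.
    obtain ⟨z, hz, hmin⟩ := s.exists_min_image h hse
    set m := h z
    have hm : 0 ≤ m := hnn z
    set h' : V → ℝ := fun x => if x ∈ s then h x - m else 0 with hh'
    have hdec : ∀ x, h x = h' x + m * (if x ∈ s then (1 : ℝ) else 0) := by
      intro x
      by_cases hx : x ∈ s
      · simp [hh', hx]
      · have : h x = 0 := by simpa using (not_congr (hmem x)).1 hx
        simp [hh', hx, this]
    have hnn' : ∀ x, 0 ≤ h' x := by
      intro x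
      by_cases hx : x ∈ s
      · simpa [hh', hx] using hmin x hx
      · simp [hh', hx]
    have hsub : ∀ x, h' x ≠ 0 → x ∈ s := by
      intro x hx
      by_contra hxs
      exact hx (by simp [hh', hxs])
    -- No cancellation occurs: `h'` is nonnegative and vanishes off `s`, so across the boundary of
    -- `s` both parts jump in the same direction.
    have habs : ∀ x y, |h x - h y| = |h' x - h' y| +
        m * |(if x ∈ s then (1 : ℝ) else 0) - (if y ∈ s then 1 else 0)| := by
      intro x y
      have hx' := hnn' x
      have hy' := hnn' y
      rw [hdec x, hdec y]
      by_cases hx : x ∈ s <;> by_cases hy : y ∈ s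
      · simp [hx, hy]
      · have : h' y = 0 := by simp [hh', hy]
        simp [hx, hy, this, abs_of_nonneg, hx', hm, add_nonneg]
      · have : h' x = 0 := by simp [hh', hx]
        simp only [hx, hy, this, if_true, if_false, zero_sub, mul_zero, mul_one, add_zero]
        rw [abs_neg, abs_neg, abs_neg, abs_of_nonneg (add_nonneg hy' hm), abs_of_nonneg hy',
          abs_one, mul_one]
      · simp [hx, hy]
    have hcard : (K.filter fun x => h' x ≠ 0).card ≤ n := by
      have : (K.filter fun x => h' x ≠ 0) ⊂ s := by
        refine Finset.ssubset_iff_subset_ne.2 ⟨fun x hx => hsub x (Finset.mem_filter.1 hx).2, ?_⟩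
        intro he
        rw [← he] at hz
        refine (Finset.mem_filter.1 hz).2 ?_
        have : z ∈ s := he ▸ hz
        simp [hh', this, m]
      have := Finset.card_lt_card this
      omega
    have h1 := ih h' hnn' (fun x hx => hK x ((hmem x).1 (hsub x hx))) hcard
    have h2 := isoperimetric_edge G K s fun x hx => hK x ((hmem x).1 hx)
    have h3 : ∑ x ∈ K, h x = ∑ x ∈ K, h' x + m * s.card := by
      simp_rw [hdec, Finset.sum_add_distrib, ← Finset.mul_sum]
      congr 2
      rw [Finset.sum_boole, Finset.filter_mem_eq_inter, Finset.inter_eq_right.2]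
      exact Finset.filter_subset _ _
    have h4 : ∑ x ∈ K, ∑ y ∈ K, adjWeight G x y * |h x - h y| =
        ∑ x ∈ K, ∑ y ∈ K, adjWeight G x y * |h' x - h' y| +
        m * ∑ x ∈ K, ∑ y ∈ K, adjWeight G x y *
          |(if x ∈ s then (1 : ℝ) else 0) - (if y ∈ s then 1 else 0)| := by
      simp_rw [habs, mul_add, Finset.sum_add_distrib, Finset.mul_sum]
      congr 1
      refine Finset.sum_congr rfl fun x _ => Finset.sum_congr rfl fun y _ => by ring
    rw [h3, h4]
    nlinarith [mul_le_mul_of_nonneg_left h2 hm]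

variable [G.LocallyFinite]

lemma sum_adjWeight_mul {K : Finset V} {x : V} (hK : ∀ y, G.Adj x y → y ∈ K) (f : V → ℝ) :
    ∑ y ∈ K, adjWeight G x y * f y = ∑ y ∈ G.neighborFinset x, f y := by
  classical
  rw [← Finset.sum_subset (s₁ := G.neighborFinset x) (s₂ := K)]
  · exact Finset.sum_congr rfl fun y hy => by
      rw [adjWeight_of_adj G ((G.mem_neighborFinset _ _).1 hy), one_mul]
  · intro y hy
    exact hK y ((G.mem_neighborFinset _ _).1 hy)
  · intro y _ hy
    rw [adjWeight_of_not_adj G (fun h => hy ((G.mem_neighborFinset _ _).2 h)), zero_mul]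

lemma sum_adjWeight_mul_left {K : Finset V} (g : V → ℝ)
    (hK : ∀ x, g x ≠ 0 → x ∈ K ∧ ∀ y, G.Adj x y → y ∈ K) :
    ∑ x ∈ K, ∑ y ∈ K, adjWeight G x y * g x = ∑ x ∈ K, (G.degree x : ℝ) * g x := by
  refine Finset.sum_congr rfl fun x _ => ?_
  by_cases hx : g x = 0
  · simp [hx]
  · rw [sum_adjWeight_mul G (hK x hx).2 fun _ => g x]
    simp

/-- Cheeger's inequality, for the quadratic form of the adjacency matrix. -/
lemma cheeger {Δ : ℕ} (hΔ : ∀ x : V, G.degree x ≤ Δ) (hna : 0 ≤ isoperimetricConstant G)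
    (K : Finset V) (f : V → ℝ)
    (hK : ∀ x, f x ≠ 0 → x ∈ K ∧ ∀ y, G.Adj x y → y ∈ K) :
    (Δ : ℝ) ^ 2 * (∑ x ∈ K, ∑ y ∈ K, adjWeight G x y * (f x * f y)) ^ 2 +
      isoperimetricConstant G ^ 2 * (∑ x ∈ K, (G.degree x : ℝ) * f x ^ 2) ^ 2 ≤
      (Δ : ℝ) ^ 2 * (∑ x ∈ K, (G.degree x : ℝ) * f x ^ 2) ^ 2 := by
  classical
  set κ := isoperimetricConstant G
  set Q := ∑ x ∈ K, ∑ y ∈ K, adjWeight G x y * (f x * f y) with hQ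
  set D := ∑ x ∈ K, (G.degree x : ℝ) * f x ^ 2 with hD
  set N := ∑ x ∈ K, f x ^ 2 with hN
  have hK2 : ∀ x, f x ^ 2 ≠ 0 → x ∈ K ∧ ∀ y, G.Adj x y → y ∈ K := fun x hx =>
    hK x (by simpa using hx)
  have hD1 : ∑ x ∈ K, ∑ y ∈ K, adjWeight G x y * f x ^ 2 = D :=
    sum_adjWeight_mul_left G (fun x => f x ^ 2) hK2
  have hD2 : ∑ x ∈ K, ∑ y ∈ K, adjWeight G x y * f y ^ 2 = D := by
    rw [← hD1]
    exact sum_adjWeight_mul_comm G K fun x _ => f x ^ 2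
  have hco := coarea G K _ (fun x => f x ^ 2) (fun x => sq_nonneg _) hK2 le_rfl
  have hDN : D ≤ Δ * N := by
    rw [hD, hN, Finset.mul_sum]
    refine Finset.sum_le_sum fun x _ => mul_le_mul_of_nonneg_right ?_ (sq_nonneg _)
    exact_mod_cast hΔ x
  have hD0 : 0 ≤ D := Finset.sum_nonneg fun x _ => by positivity
  have hN0 : 0 ≤ N := Finset.sum_nonneg fun x _ => by positivity
  have hm : ∑ x ∈ K, ∑ y ∈ K, adjWeight G x y * (f x - f y) ^ 2 = 2 * D - 2 * Q := by
    have : ∀ x y, adjWeight G x y * (f x - f y) ^ 2 = adjWeight G x y * f x ^ 2 +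
        adjWeight G x y * f y ^ 2 - 2 * (adjWeight G x y * (f x * f y)) := fun x y => by ring
    simp_rw [this, Finset.sum_sub_distrib, Finset.sum_add_distrib, ← Finset.mul_sum, hD1, hD2]
    simp_rw [← hQ]; ring
  have hp : ∑ x ∈ K, ∑ y ∈ K, adjWeight G x y * (f x + f y) ^ 2 = 2 * D + 2 * Q := by
    have : ∀ x y, adjWeight G x y * (f x + f y) ^ 2 = adjWeight G x y * f x ^ 2 +
        adjWeight G x y * f y ^ 2 + 2 * (adjWeight G x y * (f x * f y)) := fun x y => by ring
    simp_rw [this, Finset.sum_add_distrib, ← Finset.mul_sum, hD1, hD2]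
    simp_rw [← hQ]; ring
  -- Cauchy–Schwarz for the factorization $f(x)^2-f(y)^2=(f(x)-f(y))(f(x)+f(y))$. With `coarea`
  -- applied to $f^2$ this yields $\kappa^2N^2\le D^2-Q^2$.
  have hCS : (∑ x ∈ K, ∑ y ∈ K, adjWeight G x y * |f x ^ 2 - f y ^ 2|) ^ 2 ≤
      (2 * D - 2 * Q) * (2 * D + 2 * Q) := by
    rw [← hm, ← hp]
    simp_rw [← Finset.sum_product']
    refine Finset.sum_sq_le_sum_mul_sum_of_sq_le_mul _ ?_ ?_ ?_
    · exact fun p _ => mul_nonneg (adjWeight_nonneg G _ _) (sq_nonneg _)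
    · exact fun p _ => mul_nonneg (adjWeight_nonneg G _ _) (sq_nonneg _)
    · intro p _
      rw [mul_pow, sq_abs]
      exact le_of_eq (by ring)
  have h1 : (2 * κ * N) ^ 2 ≤ (2 * D - 2 * Q) * (2 * D + 2 * Q) :=
    (pow_le_pow_left₀ (by positivity) hco 2).trans hCS
  have h2 : κ ^ 2 * D ^ 2 ≤ κ ^ 2 * (Δ * N) ^ 2 :=
    mul_le_mul_of_nonneg_left (pow_le_pow_left₀ hD0 hDN 2) (sq_nonneg _)
  nlinarith [mul_le_mul_of_nonneg_left h1 (sq_nonneg (Δ : ℝ))]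

/-- Provides a finite window in which sums over neighbours of points of `s` are complete. -/
lemma exists_finset_closed (s : Finset V) :
    ∃ K : Finset V, s ⊆ K ∧ ∀ x ∈ s, ∀ y, G.Adj x y → y ∈ K := by
  classical
  refine ⟨s ∪ s.biUnion fun x => G.neighborFinset x, Finset.subset_union_left, fun x hx y hxy => ?_⟩
  exact Finset.mem_union_right _ (Finset.mem_biUnion.2 ⟨x, hx, (G.mem_neighborFinset _ _).2 hxy⟩)

/-- The transition operator of simple random walk, acting on functions. -/
noncomputable def walkOp (f : V → ℝ) (x : V) : ℝ :=
  ∑ y ∈ G.neighborFinset x, (1 / (G.degree x : ℝ)) * f y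

/-- On a non-amenable graph of bounded degree, the transition operator of simple random walk is a
strict contraction of `ℓ²`. -/
theorem exists_walkOp_contraction {Δ : ℕ} (hΔ : ∀ x : V, G.degree x ≤ Δ)
    (hpos : ∀ x : V, 0 < G.degree x) (hna : IsNonamenable G) :
    ∃ l : ℝ, 0 < l ∧ l < 1 ∧ ∀ (f : V → ℝ) (s : Finset V), (∀ x, f x ≠ 0 → x ∈ s) →
      ∀ C : ℝ, (∀ K : Finset V, ∑ x ∈ K, (G.degree x : ℝ) * f x ^ 2 ≤ C) →
      ∀ K : Finset V, ∑ x ∈ K, (G.degree x : ℝ) * walkOp G f x ^ 2 ≤ l ^ 2 * C := by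
  classical
  set κ := isoperimetricConstant G with hκ
  have hκ0 : 0 < κ := hna
  obtain hV | ⟨⟨v⟩⟩ := isEmpty_or_nonempty V
  · refine ⟨1 / 2, by norm_num, by norm_num, fun f s _ C hC K => ?_⟩
    rw [Finset.eq_empty_of_isEmpty K]
    have := hC ∅
    simp only [Finset.sum_empty] at this ⊢
    positivity
  have hΔ0 : (0 : ℝ) < Δ := by exact_mod_cast (hpos v).trans_le (hΔ v)
  -- Cheeger's inequality would allow $1-\kappa^2/\Delta^2$; this slightly larger constant is
  -- visibly positive, without comparing $\kappa$ with $\Delta$.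
  set L : ℝ := Δ ^ 2 / (Δ ^ 2 + κ ^ 2) with hL
  have hL0 : 0 < L := by positivity
  have hL1 : L < 1 := by rw [hL, div_lt_one (by positivity)]; nlinarith
  refine ⟨Real.sqrt L, Real.sqrt_pos.2 hL0, by rwa [Real.sqrt_lt' one_pos, one_pow],
    fun f s hs C hC K₀ => ?_⟩
  rw [Real.sq_sqrt hL0.le]
  set l := Real.sqrt L
  have hl0 : 0 < l := Real.sqrt_pos.2 hL0
  have hlL : l ^ 2 = L := Real.sq_sqrt hL0.le
  -- The set `s₁` contains the supports of both `f` and `walkOp G f`, and `K` contains all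
  -- neighbours of `s₁` as well as `K₀`.
  obtain ⟨s₁, hs₁, hs₁'⟩ := exists_finset_closed G s
  obtain ⟨K, hK, hK'⟩ := exists_finset_closed G (s₁ ∪ K₀)
  set g := walkOp G f with hg
  have hgs : ∀ x, g x ≠ 0 → x ∈ s₁ := by
    intro x hx
    by_contra hxs
    refine hx (Finset.sum_eq_zero fun y hy => ?_)
    have : f y = 0 := by
      by_contra hy'
      exact hxs (hs₁' y (hs y hy') x ((G.mem_neighborFinset _ _).1 hy).symm)
    rw [this, mul_zero]
  have hsupp : ∀ x ∈ s₁, x ∈ K ∧ ∀ y, G.Adj x y → y ∈ K := fun x hx =>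
    ⟨hK (Finset.mem_union_left _ hx), hK' x (Finset.mem_union_left _ hx)⟩
  have key : ∀ h : V → ℝ, (∀ x, h x ≠ 0 → x ∈ s₁) →
      |∑ x ∈ K, ∑ y ∈ K, adjWeight G x y * (h x * h y)| ≤
        l * ∑ x ∈ K, (G.degree x : ℝ) * h x ^ 2 := by
    intro h hh
    have hch := cheeger G hΔ hκ0.le K h fun x hx => hsupp x (hh x hx)
    set Q := ∑ x ∈ K, ∑ y ∈ K, adjWeight G x y * (h x * h y)
    have hD0 : 0 ≤ ∑ x ∈ K, (G.degree x : ℝ) * h x ^ 2 :=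
      Finset.sum_nonneg fun x _ => by positivity
    set D := ∑ x ∈ K, (G.degree x : ℝ) * h x ^ 2
    refine abs_le_of_sq_le_sq ?_ (by positivity)
    rw [mul_pow, hlL, hL, div_mul_eq_mul_div, le_div_iff₀ (by positivity)]
    rw [← hκ] at hch
    have hκΔ : Q ^ 2 ≤ D ^ 2 := by
      have : (Δ : ℝ) ^ 2 * Q ^ 2 ≤ Δ ^ 2 * D ^ 2 := by nlinarith [sq_nonneg (κ * D)]
      exact le_of_mul_le_mul_left this (by positivity)
    nlinarith [mul_le_mul_of_nonneg_left hκΔ (sq_nonneg κ)]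
  set Df := ∑ x ∈ K, (G.degree x : ℝ) * f x ^ 2 with hDf
  set Dg := ∑ x ∈ K, (G.degree x : ℝ) * g x ^ 2 with hDg
  set B := ∑ x ∈ K, ∑ y ∈ K, adjWeight G x y * (g x * f y) with hB
  have hBDg : B = Dg := by
    refine Finset.sum_congr rfl fun x _ => ?_
    by_cases hx : g x = 0
    · simp [hx]
    · have h1 : ∀ y, adjWeight G x y * (g x * f y) = g x * (adjWeight G x y * f y) :=
        fun y => by ring
      simp_rw [h1]
      rw [← Finset.mul_sum, sum_adjWeight_mul G (hsupp x (hgs x hx)).2]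
      have h2 : ∑ y ∈ G.neighborFinset x, f y = G.degree x * g x := by
        have : (G.degree x : ℝ) ≠ 0 := by exact_mod_cast (hpos x).ne'
        rw [hg, walkOp, ← Finset.mul_sum]
        field_simp
      rw [h2]; ring
  have hBsymm : ∑ x ∈ K, ∑ y ∈ K, adjWeight G x y * (f x * g y) = B := by
    rw [hB, ← sum_adjWeight_mul_comm G K fun x y => f x * g y]
    simp_rw [mul_comm]
  -- Polarization turns the bound on the quadratic form into a norm bound: the mixed term `B` equals
  -- `Dg`, so comparing the forms of $lf\pm g$ gives $4l\,D_g\le 2l(l^2D_f+D_g)$, that is $D_g\le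
  -- l^2D_f$.
  have hk1 := key (fun x => l * f x + g x) fun x hx => by
    by_cases h : g x = 0
    · refine hs₁ (hs x fun h' => hx ?_)
      simp [h, h']
    · exact hgs x h
  have hk2 := key (fun x => l * f x - g x) fun x hx => by
    by_cases h : g x = 0
    · refine hs₁ (hs x fun h' => hx ?_)
      simp [h, h']
    · exact hgs x h
  have e1 : ∑ x ∈ K, ∑ y ∈ K, adjWeight G x y * ((l * f x + g x) * (l * f y + g y)) -
      ∑ x ∈ K, ∑ y ∈ K, adjWeight G x y * ((l * f x - g x) * (l * f y - g y)) =
      4 * l * Dg := by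
    have : ∀ x y, adjWeight G x y * ((l * f x + g x) * (l * f y + g y)) -
        adjWeight G x y * ((l * f x - g x) * (l * f y - g y)) =
        2 * l * (adjWeight G x y * (f x * g y)) + 2 * l * (adjWeight G x y * (g x * f y)) :=
      fun x y => by ring
    simp_rw [← Finset.sum_sub_distrib, this, Finset.sum_add_distrib, ← Finset.mul_sum, hBsymm,
      ← hB, hBDg]
    ring
  have e2 : ∑ x ∈ K, (G.degree x : ℝ) * (l * f x + g x) ^ 2 +
      ∑ x ∈ K, (G.degree x : ℝ) * (l * f x - g x) ^ 2 = 2 * (L * Df + Dg) := by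
    rw [hDf, hDg, ← Finset.sum_add_distrib, mul_add, Finset.mul_sum, Finset.mul_sum,
      Finset.mul_sum, ← Finset.sum_add_distrib, ← hlL]
    exact Finset.sum_congr rfl fun x _ => by ring
  have h1 := le_of_abs_le hk1
  have h2 := neg_le_of_abs_le hk2
  have h3 : 4 * l * Dg ≤ l * (2 * (L * Df + Dg)) := by
    rw [← e1, ← e2]; linarith
  have h4 : Dg ≤ L * Df := by
    have : l * (4 * Dg) ≤ l * (2 * (L * Df + Dg)) := by linarith
    have := le_of_mul_le_mul_left this hl0
    linarith
  calc ∑ x ∈ K₀, (G.degree x : ℝ) * g x ^ 2 ≤ Dg :=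
        Finset.sum_le_sum_of_subset_of_nonneg (Finset.subset_union_right.trans hK)
          fun x _ _ => by positivity
    _ ≤ L * Df := h4
    _ ≤ L * C := mul_le_mul_of_nonneg_left (hC K) hL0.le

end Cheeger

/-! ### Transition probabilities and the spectral radius -/

section Walk

variable {V : Type*} (G : SimpleGraph V) [G.LocallyFinite]

lemma walkProb_zero_self (x : V) : walkProb G 0 x x = 1 := by simp [walkProb]

lemma walkProb_zero_of_ne {x y : V} (h : x ≠ y) : walkProb G 0 x y = 0 := by simp [walkProb, h]

lemma walkProb_succ (n : ℕ) (x y : V) : walkProb G (n + 1) x y =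
    ∑ z ∈ G.neighborFinset x, (1 / (G.degree x : ℝ)) * walkProb G n z y := rfl

lemma walkProb_nonneg (n : ℕ) (x y : V) : 0 ≤ walkProb G n x y := by
  induction n generalizing x with
  | zero => unfold walkProb; split_ifs <;> norm_num
  | succ n ih => exact Finset.sum_nonneg fun z _ => mul_nonneg (by positivity) (ih z)

lemma walkProb_le_one (n : ℕ) (x y : V) : walkProb G n x y ≤ 1 := by
  induction n generalizing x with
  | zero => unfold walkProb; split_ifs <;> norm_num
  | succ n ih =>
    rw [walkProb_succ, ← Finset.mul_sum]
    calc (1 / (G.degree x : ℝ)) * ∑ z ∈ G.neighborFinset x, walkProb G n z y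
        ≤ (1 / (G.degree x : ℝ)) * ∑ z ∈ G.neighborFinset x, 1 :=
          mul_le_mul_of_nonneg_left (Finset.sum_le_sum fun z _ => ih z) (by positivity)
      _ ≤ 1 := by
          simp only [Finset.sum_const, G.card_neighborFinset_eq_degree, nsmul_eq_mul, mul_one,
            one_div]
          exact inv_mul_le_one

/-- The last-step decomposition of the `n`-step transition probabilities. -/
lemma walkProb_succ_right (n : ℕ) (x y : V) : walkProb G (n + 1) x y =
    ∑ z ∈ G.neighborFinset y, walkProb G n x z * (1 / (G.degree z : ℝ)) := by
  classical
  induction n generalizing x with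
  | zero =>
    rw [walkProb_succ]
    by_cases h : G.Adj x y
    · rw [Finset.sum_eq_single_of_mem y ((G.mem_neighborFinset _ _).2 h)
        fun z _ hz => by rw [walkProb_zero_of_ne G hz, mul_zero],
        Finset.sum_eq_single_of_mem x ((G.mem_neighborFinset _ _).2 h.symm)
        fun z _ hz => by rw [walkProb_zero_of_ne G hz.symm, zero_mul],
        walkProb_zero_self, walkProb_zero_self]
      ring
    · rw [Finset.sum_eq_zero, Finset.sum_eq_zero]
      · intro z hz
        rw [walkProb_zero_of_ne, zero_mul]
        rintro rfl
        exact h ((G.mem_neighborFinset _ _).1 hz).symm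
      · intro z hz
        rw [walkProb_zero_of_ne, mul_zero]
        rintro rfl
        exact h ((G.mem_neighborFinset _ _).1 hz)
  | succ n ih =>
    rw [walkProb_succ]
    simp_rw [ih, Finset.mul_sum]
    rw [Finset.sum_comm]
    refine Finset.sum_congr rfl fun z _ => ?_
    rw [walkProb_succ, Finset.sum_mul]
    exact Finset.sum_congr rfl fun w _ => by ring

/-- Simple random walk is reversible with respect to the degrees. -/
lemma degree_mul_walkProb (hpos : ∀ x : V, 0 < G.degree x) (n : ℕ) (x y : V) :
    (G.degree x : ℝ) * walkProb G n x y = G.degree y * walkProb G n y x := by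
  induction n generalizing x with
  | zero =>
    by_cases h : x = y
    · rw [h]
    · rw [walkProb_zero_of_ne G h, walkProb_zero_of_ne G (Ne.symm h), mul_zero, mul_zero]
  | succ n ih =>
    rw [walkProb_succ, walkProb_succ_right, ← Finset.mul_sum]
    have hx : (G.degree x : ℝ) ≠ 0 := by exact_mod_cast (hpos x).ne'
    rw [one_div, mul_inv_cancel_left₀ hx, Finset.mul_sum]
    refine Finset.sum_congr rfl fun z _ => ?_
    have hz : (G.degree z : ℝ) ≠ 0 := by exact_mod_cast (hpos z).ne'
    rw [← mul_assoc, ← ih z]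
    field_simp

lemma walkProb_mul_le (m n : ℕ) (x y z : V) :
    walkProb G m x y * walkProb G n y z ≤ walkProb G (m + n) x z := by
  induction m generalizing x with
  | zero =>
    by_cases h : x = y
    · rw [h, walkProb_zero_self, one_mul, zero_add]
    · rw [walkProb_zero_of_ne G h, zero_mul]
      exact walkProb_nonneg G _ _ _
  | succ m ih =>
    rw [Nat.succ_add, walkProb_succ, walkProb_succ, Finset.sum_mul]
    refine Finset.sum_le_sum fun w _ => ?_
    rw [mul_assoc]
    exact mul_le_mul_of_nonneg_left (ih w) (by positivity)

lemma exists_walk_of_walkProb_ne_zero (n : ℕ) (x y : V) (h : walkProb G n x y ≠ 0) :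
    ∃ p : G.Walk x y, p.length = n := by
  induction n generalizing x with
  | zero =>
    by_cases hxy : x = y
    · subst hxy
      exact ⟨SimpleGraph.Walk.nil, rfl⟩
    · exact absurd (walkProb_zero_of_ne G hxy) h
  | succ n ih =>
    rw [walkProb_succ] at h
    obtain ⟨z, hz, hne⟩ := Finset.exists_ne_zero_of_sum_ne_zero h
    obtain ⟨p, hp⟩ := ih z (right_ne_zero_of_mul hne)
    exact ⟨SimpleGraph.Walk.cons ((G.mem_neighborFinset _ _).1 hz) p, by simp [hp]⟩

lemma walkProb_eq_zero_of_lt_dist {n : ℕ} {x y : V} (h : n < G.dist x y) :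
    walkProb G n x y = 0 := by
  by_contra hne
  obtain ⟨p, hp⟩ := exists_walk_of_walkProb_ne_zero G n x y hne
  have := SimpleGraph.dist_le p
  omega

lemma inv_degree_le_walkProb_one {x y : V} (h : G.Adj x y) :
    1 / (G.degree x : ℝ) ≤ walkProb G 1 x y := by
  rw [walkProb_succ]
  refine le_trans ?_ (Finset.single_le_sum (fun z _ => mul_nonneg (by positivity)
    (walkProb_nonneg G 0 z y)) ((G.mem_neighborFinset _ _).2 h))
  rw [walkProb_zero_self, mul_one]

variable {Δ : ℕ}

lemma inv_le_walkProb_one (hΔ : ∀ x : V, G.degree x ≤ Δ) (hpos : ∀ x : V, 0 < G.degree x)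
    {x y : V} (h : G.Adj x y) : 1 / (Δ : ℝ) ≤ walkProb G 1 x y := by
  refine le_trans ?_ (inv_degree_le_walkProb_one G h)
  exact one_div_le_one_div_of_le (by exact_mod_cast hpos x) (by exact_mod_cast hΔ x)

lemma inv_pow_le_walkProb (hΔ : ∀ x : V, G.degree x ≤ Δ) (hpos : ∀ x : V, 0 < G.degree x)
    {x y : V} (p : G.Walk x y) : (1 / (Δ : ℝ)) ^ p.length ≤ walkProb G p.length x y := by
  induction p with
  | nil => simp [walkProb]
  | @cons u v w h p ih =>
    rw [SimpleGraph.Walk.length_cons, pow_succ', add_comm p.length 1]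
    refine le_trans ?_ (walkProb_mul_le G 1 p.length u v w)
    exact mul_le_mul (inv_le_walkProb_one G hΔ hpos h) ih (by positivity) (walkProb_nonneg G _ _ _)

/-- Step back and forth along one edge. This gives arbitrarily large times of a single parity, which
suffices for a `limsup` even on bipartite graphs. -/
lemma exists_walk_add_two (hpos : ∀ x : V, 0 < G.degree x) {x y : V} (p : G.Walk x y) (m : ℕ) :
    ∃ q : G.Walk x y, q.length = p.length + 2 * m := by
  induction m with
  | zero => exact ⟨p, rfl⟩
  | succ m ih =>
    obtain ⟨q, hq⟩ := ih
    obtain ⟨z, hz⟩ := (G.degree_pos_iff_exists_adj x).1 (hpos x)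
    exact ⟨.cons hz (.cons hz.symm q), by simp [hq]; ring⟩

lemma walkProb_rpow_le_one (n : ℕ) (x y : V) : walkProb G n x y ^ (1 / (n : ℝ)) ≤ 1 :=
  Real.rpow_le_one (walkProb_nonneg G _ _ _) (walkProb_le_one G _ _ _) (by positivity)

lemma isBoundedUnder_walkProb_rpow (x y : V) : IsBoundedUnder (· ≤ ·) atTop
    fun n : ℕ => walkProb G n x y ^ (1 / (n : ℝ)) :=
  isBoundedUnder_of ⟨1, fun n => walkProb_rpow_le_one G n x y⟩

lemma isCoboundedUnder_walkProb_rpow (x y : V) : IsCoboundedUnder (· ≤ ·) atTop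
    fun n : ℕ => walkProb G n x y ^ (1 / (n : ℝ)) :=
  IsBoundedUnder.isCoboundedUnder_le
    (isBoundedUnder_of ⟨0, fun n => Real.rpow_nonneg (walkProb_nonneg G n x y) _⟩)

/-- Following one prescribed walk of length $n$ has probability at least $\Delta^{-n}$, so
$\rho\ge1/\Delta$. Without this, $1/\rho$ could take the default value 0 in the threshold. -/
lemma walkSpectralRadius_pos (hconn : G.Connected) (hΔ : ∀ x : V, G.degree x ≤ Δ)
    (hpos : ∀ x : V, 0 < G.degree x) (x y : V) : 0 < walkSpectralRadius G x y := by
  have hΔ0 : (0 : ℝ) < Δ := by exact_mod_cast (hpos x).trans_le (hΔ x)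
  refine lt_of_lt_of_le (one_div_pos.2 hΔ0) (le_limsup_of_frequently_le ?_
    (isBoundedUnder_walkProb_rpow G x y))
  rw [frequently_atTop]
  intro N
  obtain ⟨p⟩ := hconn.preconnected x y
  obtain ⟨q, hq⟩ := exists_walk_add_two G hpos p (N + 1)
  refine ⟨q.length, by omega, ?_⟩
  have hq0 : q.length ≠ 0 := by omega
  calc (1 / (Δ : ℝ)) = ((1 / (Δ : ℝ)) ^ q.length) ^ (1 / (q.length : ℝ)) := by
        rw [one_div (q.length : ℝ), Real.pow_rpow_inv_natCast (by positivity) hq0]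
    _ ≤ _ := Real.rpow_le_rpow (by positivity) (inv_pow_le_walkProb G hΔ hpos q) (by positivity)

/-- Kesten's theorem: the spectral radius of a non-amenable graph of bounded degree is less
than one. -/
theorem walkSpectralRadius_lt_one (hΔ : ∀ x : V, G.degree x ≤ Δ)
    (hpos : ∀ x : V, 0 < G.degree x) (hna : IsNonamenable G) (x y : V) :
    walkSpectralRadius G x y < 1 := by
  classical
  obtain ⟨l, hl0, hl1, hcon⟩ := exists_walkOp_contraction G hΔ hpos hna
  -- The function $z\mapsto p^{(n)}(z,y)$ is the $n$-th iterate of `walkOp` on the indicator of `y`,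
  -- whose squared norm is the degree of `y`.
  have hbound : ∀ n, (∃ s : Finset V, ∀ z, walkProb G n z y ≠ 0 → z ∈ s) ∧
      ∀ K : Finset V, ∑ z ∈ K, (G.degree z : ℝ) * walkProb G n z y ^ 2 ≤
        (l ^ 2) ^ n * G.degree y := by
    intro n
    induction n with
    | zero =>
      have hne : ∀ z, z ≠ y → (G.degree z : ℝ) * walkProb G 0 z y ^ 2 = 0 := fun z hz => by
        rw [walkProb_zero_of_ne G hz]; ring
      refine ⟨⟨{y}, fun z hz => ?_⟩, fun K => ?_⟩
      · by_contra h
        exact hz (walkProb_zero_of_ne G (by simpa using h))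
      · calc ∑ z ∈ K, (G.degree z : ℝ) * walkProb G 0 z y ^ 2
            ≤ ∑ z ∈ insert y K, (G.degree z : ℝ) * walkProb G 0 z y ^ 2 :=
              Finset.sum_le_sum_of_subset_of_nonneg (Finset.subset_insert _ _)
                fun z _ _ => by positivity
          _ = (l ^ 2) ^ 0 * G.degree y := by
              rw [Finset.sum_eq_single_of_mem y (Finset.mem_insert_self _ _)
                fun z _ hz => hne z hz, walkProb_zero_self]
              ring
    | succ n ih =>
      obtain ⟨⟨s, hs⟩, hK⟩ := ih
      refine ⟨?_, fun K => ?_⟩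
      · obtain ⟨K, hsK, hK'⟩ := exists_finset_closed G s
        refine ⟨K, fun z hz => ?_⟩
        rw [walkProb_succ] at hz
        obtain ⟨w, hw, hne⟩ := Finset.exists_ne_zero_of_sum_ne_zero hz
        exact hK' w (hs w (right_ne_zero_of_mul hne)) z ((G.mem_neighborFinset _ _).1 hw).symm
      · have := hcon (fun z => walkProb G n z y) s hs _ hK K
        rw [pow_succ', mul_assoc]
        exact this
  have hle : ∀ n, walkProb G n x y ≤ Real.sqrt (G.degree y) * l ^ n := by
    intro n
    have h := (hbound n).2 {x}
    rw [Finset.sum_singleton] at h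
    refine le_of_sq_le_sq ?_ (by positivity)
    rw [mul_pow, Real.sq_sqrt (by positivity), ← pow_mul, mul_comm n 2, pow_mul]
    have hd : (1 : ℝ) ≤ G.degree x := by exact_mod_cast hpos x
    nlinarith [sq_nonneg (walkProb G n x y)]
  -- A rate strictly between `l` and 1 absorbs the constant prefactor for large `n`.
  set l' := (l + 1) / 2
  have hl'0 : 0 < l' := by positivity
  have hll' : l < l' := by simp only [l']; linarith
  have hl'1 : l' < 1 := by simp only [l']; linarith
  refine lt_of_le_of_lt (limsup_le_of_le (isCoboundedUnder_walkProb_rpow G x y) ?_) hl'1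
  have hlim : Tendsto (fun n : ℕ => Real.sqrt (G.degree y) * (l / l') ^ n) atTop (𝓝 0) := by
    simpa using (tendsto_pow_atTop_nhds_zero_of_lt_one (by positivity)
      ((div_lt_one hl'0).2 hll')).const_mul (Real.sqrt (G.degree y))
  filter_upwards [hlim.eventually (gt_mem_nhds one_pos), eventually_ge_atTop 1] with n hn hn1
  calc walkProb G n x y ^ (1 / (n : ℝ)) ≤ (l' ^ n) ^ (1 / (n : ℝ)) := by
        refine Real.rpow_le_rpow (walkProb_nonneg G _ _ _) ((hle n).trans ?_) (by positivity)
        rw [div_pow, mul_div_assoc', div_lt_one (by positivity)] at hn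
        exact hn.le
    _ = l' := by rw [one_div, Real.pow_rpow_inv_natCast hl'0.le (by omega)]

/-- Above the spectral radius, the `n`-step transition probabilities decay exponentially, uniformly
in the end point. -/
lemma exists_walkProb_le (hconn : G.Connected) (hΔ : ∀ x : V, G.degree x ≤ Δ)
    (hpos : ∀ x : V, 0 < G.degree x) (o o' x : V) {r : ℝ} (hr : walkSpectralRadius G o o' < r) :
    ∃ (C : ℝ) (N : ℕ), 0 ≤ C ∧ ∀ n ≥ N, ∀ y, walkProb G n x y ≤ C * r ^ n := by
  have hr0 : 0 < r := (walkSpectralRadius_pos G hconn hΔ hpos o o').trans hr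
  obtain ⟨N, hN⟩ := eventually_atTop.1
    (eventually_lt_of_limsup_lt hr (isBoundedUnder_walkProb_rpow G o o'))
  have hN' : ∀ n ≥ N + 1, walkProb G n o o' ≤ r ^ n := by
    intro n hn
    have h := pow_le_pow_left₀ (Real.rpow_nonneg (walkProb_nonneg G n o o') _)
      (hN n (by omega)).le n
    rwa [one_div, Real.rpow_inv_natCast_pow (walkProb_nonneg G n o o') (by omega)] at h
  have hΔ0 : (0 : ℝ) < Δ := by exact_mod_cast (hpos x).trans_le (hΔ x)
  -- These walks compare $p^{(2n)}(x,x)$ with a transition probability from `o` to `o'`, at the cost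
  -- of the constants `c` and `c'`.
  obtain ⟨p⟩ := hconn.preconnected o x
  obtain ⟨q⟩ := hconn.preconnected x o'
  set c := walkProb G p.length o x
  set c' := walkProb G q.length x o'
  have hc : 0 < c := lt_of_lt_of_le (by positivity) (inv_pow_le_walkProb G hΔ hpos p)
  have hc' : 0 < c' := lt_of_lt_of_le (by positivity) (inv_pow_le_walkProb G hΔ hpos q)
  set A := Δ * (r ^ (p.length + q.length) / (c * c'))
  refine ⟨Real.sqrt A, N + 1, Real.sqrt_nonneg _, fun n hn y => ?_⟩
  refine le_of_sq_le_sq ?_ (by positivity)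
  rw [mul_pow, Real.sq_sqrt (by positivity)]
  -- Reversibility removes the end point:
  -- $p^{(n)}(x,y)^2\le\Delta\,p^{(n)}(x,y)\,p^{(n)}(y,x)\le\Delta\,p^{(2n)}(x,x)$.
  have h1 : walkProb G n x y ≤ Δ * walkProb G n y x := by
    have hx : (1 : ℝ) ≤ G.degree x := by exact_mod_cast hpos x
    have hy : (G.degree y : ℝ) ≤ Δ := by exact_mod_cast hΔ y
    have := degree_mul_walkProb G hpos n x y
    nlinarith [walkProb_nonneg G n x y, walkProb_nonneg G n y x]
  have h2 := walkProb_mul_le G n n x y x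
  have h3 : c * walkProb G (n + n) x x * c' ≤ r ^ (p.length + (n + n) + q.length) :=
    ((mul_le_mul_of_nonneg_right (walkProb_mul_le G _ _ _ _ _) hc'.le).trans
      (walkProb_mul_le G _ _ _ _ _)).trans (hN' _ (by omega))
  have h4 : walkProb G (n + n) x x ≤ r ^ (p.length + q.length) / (c * c') * (r ^ n) ^ 2 := by
    rw [div_mul_eq_mul_div, le_div_iff₀ (by positivity)]
    calc _ = c * walkProb G (n + n) x x * c' := by ring
      _ ≤ _ := h3
      _ = _ := by ring
  calc walkProb G n x y ^ 2 ≤ Δ * (walkProb G n x y * walkProb G n y x) := by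
        nlinarith [walkProb_nonneg G n x y]
    _ ≤ Δ * (r ^ (p.length + q.length) / (c * c') * (r ^ n) ^ 2) :=
        mul_le_mul_of_nonneg_left (h2.trans h4) hΔ0.le
    _ = A * (r ^ n) ^ 2 := by simp only [A]; ring

end Walk

/-! ### Means of the offspring laws and uniformity of the labels -/

section Laws

/-- Tail-sum formula: child number `j` exists exactly when the offspring number exceeds `j`, so
these probabilities add up to the mean. -/
lemma tsum_measure_lt_eq_lintegral (μ : Measure ℕ) :
    ∑' j : ℕ, μ {k | j < k} = ∫⁻ k, (k : ℝ≥0∞) ∂μ := by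
  have h : ∀ k : ℕ, (k : ℝ≥0∞) = ∑' j : ℕ, Set.indicator {k : ℕ | j < k} 1 k := by
    intro k
    rw [tsum_eq_sum (s := Finset.range k) fun j hj => by simpa [Set.indicator] using hj]
    rw [Finset.sum_congr rfl fun j hj => ?_, Finset.sum_const, Finset.card_range, nsmul_one]
    simpa [Set.indicator] using hj
  simp_rw [h]
  rw [lintegral_tsum fun j => Measurable.aemeasurable measurable_from_top]
  simp_rw [lintegral_indicator_one (MeasurableSet.of_discrete (s := _))]

lemma lintegral_poissonMeasure_id (r : ℝ≥0) : ∫⁻ k, (k : ℝ≥0∞) ∂(poissonMeasure r) = r := by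
  have hone : ∑' k : ℕ, poissonMeasure r {k} = 1 := by
    have h := lintegral_countable' (μ := poissonMeasure r) (1 : ℕ → ℝ≥0∞)
    simpa using h.symm
  have hstep : ∀ k : ℕ, ((k + 1 : ℕ) : ℝ≥0∞) * poissonMeasure r {k + 1} =
      r * poissonMeasure r {k} := by
    intro k
    rw [poissonMeasure_singleton, poissonMeasure_singleton, ← ENNReal.ofReal_natCast,
      ← ENNReal.ofReal_coe_nnreal, ← ENNReal.ofReal_mul (by positivity),
      ← ENNReal.ofReal_mul (by positivity)]
    congr 1
    rw [Nat.factorial_succ]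
    push_cast
    field_simp
    ring
  rw [lintegral_countable', tsum_eq_zero_add' ENNReal.summable]
  simp_rw [hstep]
  rw [ENNReal.tsum_mul_left, hone]
  simp

/-- Each residue class modulo `d` meets an interval of `d * q` consecutive integers in exactly `q`
points. Used with $N=\Delta!$, it makes each jump uniform over the neighbours. -/
lemma uniformOn_natCast_eq {d N : ℕ} (hd : 0 < d) (hdN : d ∣ N) (hN : 0 < N) (c : ZMod d) :
    uniformOn (Set.Icc 1 N) {k : ℕ | (k : ZMod d) = c} = ENNReal.ofReal (1 / d) := by
  classical
  have : NeZero d := ⟨hd.ne'⟩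
  obtain ⟨q, rfl⟩ := hdN
  have hq : 0 < q := Nat.pos_of_mul_pos_left hN
  have hset : Set.Icc 1 (d * q) = ((Finset.Ioc 0 (d * q) : Finset ℕ) : Set ℕ) := by
    ext k; simp [Nat.succ_le_iff]
  have hcard : ((Finset.Ioc 0 (d * q)).filter fun k : ℕ => (k : ZMod d) = c).card = q := by
    have h := Nat.Ioc_filter_modEq_card 0 (d * q) hd c.val
    have hf : ((Finset.Ioc 0 (d * q)).filter fun k : ℕ => (k : ZMod d) = c) =
        (Finset.Ioc 0 (d * q)).filter fun k : ℕ => k ≡ c.val [MOD d] := by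
      refine Finset.filter_congr fun k _ => ?_
      rw [← ZMod.natCast_eq_natCast_iff, ZMod.natCast_zmod_val]
    rw [hf]
    have hd' : (d : ℚ) ≠ 0 := by exact_mod_cast hd.ne'
    have e : (((d * q : ℕ) : ℚ) - (c.val : ℚ)) / d = ((0 : ℕ) - (c.val : ℚ)) / d + (q : ℕ) := by
      push_cast; field_simp; ring
    rw [e, Int.floor_add_natCast] at h
    have : (0 : ℤ) ≤ q := by positivity
    zify
    rw [h]
    simp
  rw [← uniformOn_inter_self (Set.finite_Icc _ _), hset]
  have hinter : ((Finset.Ioc 0 (d * q) : Finset ℕ) : Set ℕ) ∩ {k : ℕ | (k : ZMod d) = c} =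
      (((Finset.Ioc 0 (d * q)).filter fun k : ℕ => (k : ZMod d) = c : Finset ℕ) : Set ℕ) := by
    ext k; simp
  rw [hinter, uniformOn_apply_finset, Finset.inter_eq_right.2 (Finset.filter_subset _ _), hcard,
    Nat.card_Ioc, Nat.sub_zero, one_div, ENNReal.ofReal_inv_of_pos (by exact_mod_cast hd),
    ENNReal.ofReal_natCast]
  push_cast
  rw [← one_mul (q : ℝ≥0∞), ← mul_assoc, mul_one, ENNReal.mul_div_mul_right, one_div]
  · exact_mod_cast hq.ne'
  · exact ENNReal.natCast_ne_top q

end Laws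

/-! ### Generation masses and the randomness used by an individual -/

section Tree

/-- The number of edges between an individual and its ancestor in the first generation. -/
def Individual.gen : Individual → ℕ
  | .root _ => 0
  | .child a _ _ => a.gen + 1

/-- A numbering of the types. -/
def Kind.code : Kind → ℕ
  | .circ => 0
  | .bullet => 1

/-- An encoding of individuals by lists of pairs of natural numbers. -/
def Individual.code : Individual → List (ℕ × ℕ)
  | .root i => [(0, i)]
  | .child a t j => (t.code, j) :: a.code

lemma Kind.code_injective : Function.Injective Kind.code := by
  intro s t h
  cases s <;> cases t <;> simp_all [Kind.code]

lemma Individual.code_ne_nil (a : Individual) : a.code ≠ [] := by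
  cases a <;> simp [Individual.code]

lemma Individual.code_injective : Function.Injective Individual.code := by
  intro a
  induction a with
  | root i =>
    intro b h
    cases b with
    | root j => simpa [Individual.code] using h
    | child b t j => simp [Individual.code, (b.code_ne_nil).symm] at h
  | child a t j ih =>
    intro b h
    cases b with
    | root j => simp [Individual.code, a.code_ne_nil] at h
    | child b t' j' =>
      simp only [Individual.code, List.cons.injEq, Prod.mk.injEq] at h
      rw [ih h.2, Kind.code_injective h.1.1, h.1.2]

instance : Countable Individual := Individual.code_injective.countable

/-- Individuals are either in the first generation or descendants. -/
def individualEquiv : ℕ ⊕ (Individual × Kind × ℕ) ≃ Individual where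
  toFun := Sum.elim Individual.root fun p => Individual.child p.1 p.2.1 p.2.2
  invFun
    | .root i => Sum.inl i
    | .child a t j => Sum.inr (a, t, j)
  left_inv := by rintro (i | ⟨a, t, j⟩) <;> rfl
  right_inv := by rintro (i | ⟨a, t, j⟩) <;> rfl

/-- The two types, as booleans. -/
def kindEquiv : Bool ≃ Kind where
  toFun b := if b then .circ else .bullet
  invFun
    | .circ => true
    | .bullet => false
  left_inv := by rintro (_ | _) <;> rfl
  right_inv := by rintro (_ | _) <;> rfl

lemma tsum_kind (f : Kind → ℝ≥0∞) : ∑' t, f t = f .circ + f .bullet := by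
  rw [← kindEquiv.tsum_eq f, tsum_fintype]
  simp [kindEquiv]

lemma tsum_individual (f : Individual → ℝ≥0∞) :
    ∑' a, f a = ∑' i, f (.root i) + ∑' a, ∑' t, ∑' j, f (.child a t j) := by
  rw [← individualEquiv.tsum_eq f, ENNReal.summable.tsum_sum ENNReal.summable]
  congr 1
  rw [ENNReal.tsum_prod']
  refine tsum_congr fun a => ?_
  rw [ENNReal.tsum_prod']
  rfl

/-- The weight of an individual, namely the probability that it belongs to the tree. -/
noncomputable def Individual.weight (r : ℝ≥0) : Individual → ℝ≥0∞
  | .root i => poissonMeasure r {k | i < k}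
  | .child a t j => a.weight r * offspringLaw r a.kind t {k | j < k}

/-- A super-eigenvector of the matrix of mean offspring numbers, with eigenvalue `1 + 2 r`. -/
noncomputable def Kind.value : Kind → ℝ≥0∞
  | .circ => 2
  | .bullet => 1

lemma Kind.one_le_value (t : Kind) : 1 ≤ t.value := by
  cases t <;> simp [Kind.value]

open Classical in
/-- The expected total value of the individuals in generation `n`. -/
noncomputable def genMass (r : ℝ≥0) (n : ℕ) : ℝ≥0∞ :=
  ∑' a : Individual, if a.gen = n then a.weight r * a.kind.value else 0

/-- The two rows read $2r+2\le(1+2r)\cdot2$ and $2r+1=1+2r$. -/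
lemma tsum_value_mul_mean_le (r : ℝ≥0) (s : Kind) :
    ∑' t, ∑' j : ℕ, offspringLaw r s t {k | j < k} * t.value ≤ (1 + 2 * r) * s.value := by
  simp_rw [ENNReal.tsum_mul_right, tsum_measure_lt_eq_lintegral, tsum_kind]
  cases s
  · simp only [offspringLaw, lintegral_poissonMeasure_id, lintegral_dirac, Kind.value]
    rw [add_mul, add_comm]
    push_cast
    refine add_le_add (by simp) ?_
    rw [mul_comm 2 (r : ℝ≥0∞)]
    exact le_mul_of_one_le_right' one_le_two
  · simp only [offspringLaw, lintegral_poissonMeasure_id, lintegral_dirac, Kind.value]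
    simp [add_comm, mul_comm]

lemma genMass_zero (r : ℝ≥0) : genMass r 0 = 2 * r := by
  rw [genMass, tsum_individual]
  simp only [Individual.gen, Individual.weight, Individual.kind, Kind.value, if_true,
    Nat.add_eq_zero_iff, one_ne_zero, and_false, if_false, tsum_zero, add_zero]
  rw [ENNReal.tsum_mul_right, tsum_measure_lt_eq_lintegral, lintegral_poissonMeasure_id, mul_comm]

lemma genMass_succ_le (r : ℝ≥0) (n : ℕ) : genMass r (n + 1) ≤ (1 + 2 * r) * genMass r n := by
  classical
  rw [genMass, tsum_individual, genMass, ← ENNReal.tsum_mul_left]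
  simp only [Individual.gen, Individual.weight, Individual.kind, add_left_inj,
    (Nat.succ_ne_zero n).symm, if_false, tsum_zero, zero_add]
  refine ENNReal.tsum_le_tsum fun a => ?_
  split_ifs
  · simp_rw [mul_assoc, ENNReal.tsum_mul_left]
    rw [mul_left_comm]
    exact mul_le_mul_right (tsum_value_mul_mean_le r a.kind) _
  · simp

lemma genMass_le (r : ℝ≥0) (n : ℕ) : genMass r n ≤ (1 + 2 * r) ^ n * (2 * r) := by
  induction n with
  | zero => simp [genMass_zero]
  | succ n ih =>
    refine (genMass_succ_le r n).trans ?_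
    rw [pow_succ', mul_assoc]
    exact mul_le_mul_right ih _

/-- Group the individuals by generation; inserting the values only increases the sum, as they are at
least 1. -/
lemma tsum_weight_mul_le (r : ℝ≥0) (p : ℕ → ℝ≥0∞) :
    ∑' a : Individual, a.weight r * p a.gen ≤ ∑' n, genMass r n * p n := by
  classical
  simp_rw [genMass, ← ENNReal.tsum_mul_right]
  rw [ENNReal.tsum_comm]
  refine ENNReal.tsum_le_tsum fun a => ?_
  refine le_trans ?_ (ENNReal.le_tsum a.gen)
  simp only [if_true]
  exact mul_le_mul_left (le_mul_of_one_le_right' a.kind.one_le_value) _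

/-- The sources on which the position of an individual and its membership in the tree depend. -/
def Individual.sources : Individual → Set Source
  | .root _ => {.initial}
  | .child a t j => a.sources ∪ {.offspring a t, .label a t j}

/-- Only strict ancestors contribute offspring numbers and labels to the sources of `a`. Hence the
variables attached to the birth of a child of `a` are fresh, as `Individual.disjoint_sources`
records. -/
lemma Individual.gen_lt_of_offspring_mem {a b : Individual} {t : Kind}
    (h : Source.offspring b t ∈ a.sources) : b.gen < a.gen := by
  induction a with
  | root i => simp [Individual.sources] at h
  | child a t' j ih =>
    simp only [Individual.sources, Set.mem_union, Set.mem_insert_iff, Set.mem_singleton_iff,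
      Source.offspring.injEq, reduceCtorEq, or_false] at h
    rcases h with h | ⟨rfl, -⟩
    · exact (ih h).trans (Nat.lt_succ_self _)
    · exact Nat.lt_succ_self _

lemma Individual.gen_lt_of_label_mem {a b : Individual} {t : Kind} {i : ℕ}
    (h : Source.label b t i ∈ a.sources) : b.gen < a.gen := by
  induction a with
  | root i => simp [Individual.sources] at h
  | child a t' j ih =>
    simp only [Individual.sources, Set.mem_union, Set.mem_insert_iff, Set.mem_singleton_iff,
      Source.label.injEq, reduceCtorEq, false_or] at h
    rcases h with h | ⟨rfl, -⟩
    · exact (ih h).trans (Nat.lt_succ_self _)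
    · exact Nat.lt_succ_self _

lemma Individual.disjoint_sources (a : Individual) (t : Kind) (j : ℕ) :
    Disjoint a.sources {Source.offspring a t, Source.label a t j} := by
  rw [Set.disjoint_right]
  rintro i (rfl | rfl) h
  · exact (Individual.gen_lt_of_offspring_mem h).false
  · exact (Individual.gen_lt_of_label_mem h).false

end Tree

/-! ### First moment bound for the branching random walk -/

section Walk

variable {V : Type*} (G : SimpleGraph V) [G.LocallyFinite]
  (φ : ∀ y : V, ZMod (G.degree y) ≃ G.neighborSet y) (x : V) {S : Type*}

/-- The event that the individual `a` belongs to the tree and sits at `y`. -/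
def sitsAt (X : Source → S → ℕ) (a : Individual) (y : V) : Set S :=
  {s | InTree X s a ∧ position G φ x X s a = y}

/-- Splitting by the parent's position gives a finite union, in which each piece is an event of the
past intersected with two events on fresh variables. -/
lemma sitsAt_child (X : Source → S → ℕ) (a : Individual) (t : Kind) (j : ℕ) (y : V) :
    sitsAt G φ x X (.child a t j) y = ⋃ z ∈ G.neighborFinset y, sitsAt G φ x X a z ∩
      ({s | j < X (.offspring a t) s} ∩
        {s | (φ z ((X (.label a t j) s : ℕ) : ZMod (G.degree z)) : V) = y}) := by
  ext s
  simp only [sitsAt, InTree, position, Set.mem_ofPred_eq, Set.mem_iUnion, Set.mem_inter_iff]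
  constructor
  · rintro ⟨⟨h1, h2⟩, h3⟩
    refine ⟨position G φ x X s a, ?_, ⟨h1, rfl⟩, h2, h3⟩
    rw [G.mem_neighborFinset, ← h3]
    exact (φ _ _).2.symm
  · rintro ⟨z, -, ⟨h1, rfl⟩, h2, h3⟩
    exact ⟨⟨h1, h2⟩, h3⟩

/-- Measurability with respect to the ancestral sources alone is what allows independence from the
next birth and jump to be used. -/
lemma measurableSet_sitsAt (X : Source → S → ℕ) (a : Individual) (y : V) :
    MeasurableSet[⨆ i ∈ a.sources, MeasurableSpace.comap (X i) ⊤] (sitsAt G φ x X a y) := by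
  induction a generalizing y with
  | root i =>
    by_cases h : x = y
    · have : sitsAt G φ x X (.root i) y = X .initial ⁻¹' {k | i < k} := by
        ext s; simp [sitsAt, InTree, position, h]
      rw [this]
      refine le_iSup₂ (f := fun k (_ : k ∈ (Individual.root i).sources) =>
        MeasurableSpace.comap (X k) ⊤) Source.initial rfl _ ⟨_, trivial, rfl⟩
    · have : sitsAt G φ x X (.root i) y = ∅ := by
        ext s; simp [sitsAt, position, h]
      rw [this]
      exact @MeasurableSet.empty _ (_)
  | child a t j ih =>
    rw [sitsAt_child]
    have hle : ∀ k ∈ (Individual.child a t j).sources, MeasurableSpace.comap (X k) ⊤ ≤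
        ⨆ i ∈ (Individual.child a t j).sources, MeasurableSpace.comap (X i) ⊤ := fun k hk =>
      le_iSup₂ (f := fun k (_ : k ∈ (Individual.child a t j).sources) =>
        MeasurableSpace.comap (X k) ⊤) k hk
    refine @Finset.measurableSet_biUnion _ _ (_) _ _ fun z _ => ?_
    refine @MeasurableSet.inter _ (_) _ _ ?_ (@MeasurableSet.inter _ (_) _ _ ?_ ?_)
    · exact iSup₂_le (fun k hk => hle k (Or.inl hk)) _ (ih z)
    · exact hle (.offspring a t) (Or.inr (Or.inl rfl)) _ ⟨{k | j < k}, trivial, rfl⟩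
    · exact hle (.label a t j) (Or.inr (Or.inr rfl)) _
        ⟨{k | (φ z ((k : ℕ) : ZMod (G.degree z)) : V) = y}, trivial, rfl⟩

variable {G x}

/-- A bound for the probability that an individual belongs to the tree and sits at `y`. -/
lemma measure_sitsAt_le {Δ : ℕ} (hΔ : ∀ x : V, G.degree x ≤ Δ) (hpos : ∀ x : V, 0 < G.degree x)
    [MeasurableSpace S] {P : Measure S} [IsProbabilityMeasure P] {u : ℝ≥0}
    {X : Source → S → ℕ} (hX : IsDriving P Δ u X) (a : Individual) (y : V) :
    P (sitsAt G φ x X a y) ≤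
      a.weight (u * (Δ : ℝ≥0) ^ 2) * ENNReal.ofReal (walkProb G a.gen x y) := by
  induction a generalizing y with
  | root i =>
    by_cases h : x = y
    · have : sitsAt G φ x X (.root i) y = X .initial ⁻¹' {k | i < k} := by
        ext s; simp [sitsAt, InTree, position, h]
      rw [this, ← Measure.map_apply (hX.measurable _) MeasurableSet.of_discrete, hX.law]
      simp [sourceLaw, Individual.weight, Individual.gen, h, walkProb_zero_self]
    · have : sitsAt G φ x X (.root i) y = ∅ := by
        ext s; simp [sitsAt, position, h]
      rw [this, measure_empty]
      exact zero_le
  | child a t j ih =>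
    set r := u * (Δ : ℝ≥0) ^ 2
    rw [sitsAt_child]
    refine (measure_biUnion_finset_le _ _).trans ?_
    have hterm : ∀ z ∈ G.neighborFinset y, P (sitsAt G φ x X a z ∩
        ({s | j < X (.offspring a t) s} ∩
          {s | (φ z ((X (.label a t j) s : ℕ) : ZMod (G.degree z)) : V) = y})) ≤
        (Individual.child a t j).weight r *
          ENNReal.ofReal (walkProb G a.gen x z * (1 / G.degree z)) := by
      intro z hz
      have hadj : y ∈ G.neighborSet z := ((G.mem_neighborFinset _ _).1 hz).symm
      have hlab : {s | (φ z ((X (.label a t j) s : ℕ) : ZMod (G.degree z)) : V) = y} =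
          X (.label a t j) ⁻¹' {k : ℕ | (k : ZMod (G.degree z)) = (φ z).symm ⟨y, hadj⟩} := by
        ext s
        simp only [Set.mem_ofPred_eq, Set.mem_preimage, Equiv.eq_symm_apply, Subtype.ext_iff]
      have hoff : {s | j < X (.offspring a t) s} = X (.offspring a t) ⁻¹' {k | j < k} := rfl
      have hind := indep_iSup_of_disjoint (fun i => (hX.measurable i).comap_le) hX.indep.iIndep
        (a.disjoint_sources t j)
      have hle : ∀ k ∈ ({.offspring a t, .label a t j} : Set Source),
          MeasurableSpace.comap (X k) ⊤ ≤ ⨆ i ∈ ({.offspring a t, .label a t j} : Set Source),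
            MeasurableSpace.comap (X i) ⊤ := fun k hk =>
        le_iSup₂ (f := fun k (_ : k ∈ ({.offspring a t, .label a t j} : Set Source)) =>
          MeasurableSpace.comap (X k) ⊤) k hk
      have hpair := hX.indep.indepFun (i := .offspring a t) (j := .label a t j) (by simp)
      rw [hlab, hoff, (Indep_iff _ _ _).1 hind _ _ (measurableSet_sitsAt G φ x X a z)
        (@MeasurableSet.inter _ (_) _ _
          (hle _ (Or.inl rfl) _ ⟨_, trivial, rfl⟩) (hle _ (Or.inr rfl) _ ⟨_, trivial, rfl⟩)),
        hpair.measure_inter_preimage_eq_mul _ _ MeasurableSet.of_discrete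
          MeasurableSet.of_discrete,
        ← Measure.map_apply (hX.measurable _) MeasurableSet.of_discrete, hX.law,
        ← Measure.map_apply (hX.measurable _) MeasurableSet.of_discrete, hX.law]
      simp only [sourceLaw]
      rw [uniformOn_natCast_eq (hpos z) (Nat.dvd_factorial (hpos z) (hΔ z))
        (Nat.factorial_pos _), ENNReal.ofReal_mul (walkProb_nonneg G _ _ _), Individual.weight]
      refine (mul_le_mul_left (ih z) _).trans (le_of_eq ?_)
      ring
    -- Summing over the parent's position is the last-step decomposition of the walk.
    refine (Finset.sum_le_sum hterm).trans (le_of_eq ?_)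
    rw [← Finset.mul_sum, ← ENNReal.ofReal_sum_of_nonneg fun z _ =>
      mul_nonneg (walkProb_nonneg G _ _ _) (by positivity), Individual.gen, walkProb_succ_right]

/-- The first moment bound for the probability of visiting `y`. -/
lemma measure_visits_le {Δ : ℕ} (hΔ : ∀ x : V, G.degree x ≤ Δ) (hpos : ∀ x : V, 0 < G.degree x)
    [MeasurableSpace S] {P : Measure S} [IsProbabilityMeasure P] {u r : ℝ≥0}
    (hr : r = u * (Δ : ℝ≥0) ^ 2)
    {X : Source → S → ℕ} (hX : IsDriving P Δ u X) (y : V) :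
    P (visits G φ x X y) ≤
      ∑' n : ℕ, (1 + 2 * (r : ℝ≥0∞)) ^ n * (2 * r) * ENNReal.ofReal (walkProb G n x y) := by
  have h : visits G φ x X y = ⋃ a : Individual, sitsAt G φ x X a y := by
    ext s; simp [visits, sitsAt]
  rw [h]
  refine (measure_iUnion_le _).trans ?_
  refine (ENNReal.tsum_le_tsum fun a => hr ▸ measure_sitsAt_le φ hΔ hpos hX a y).trans ?_
  refine (tsum_weight_mul_le r fun n => ENNReal.ofReal (walkProb G n x y)).trans ?_
  exact ENNReal.tsum_le_tsum fun n => mul_le_mul_left (genMass_le r n) _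

end Walk

end TwoTypeBRW

open TwoTypeBRW

theorem proposition6p2 {V : Type*} [Infinite V] (G : SimpleGraph V) [G.LocallyFinite]
    (hconn : G.Connected) (hna : IsNonamenable G)
    (Δ : ℕ) (hΔ : ∀ x : V, G.degree x ≤ Δ) (o o' : V) :
    0 < threshold Δ (walkSpectralRadius G o o') ∧
      ∀ (φ : ∀ y : V, ZMod (G.degree y) ≃ G.neighborSet y) (x : V) (u : ℝ≥0),
        (u : ℝ) < threshold Δ (walkSpectralRadius G o o') →
        ∀ (S : Type*) [MeasurableSpace S] (P : Measure S) [IsProbabilityMeasure P]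
          (X : Source → S → ℕ), IsDriving P Δ u X →
          Tendsto (fun y : V => P (visits G φ x X y))
            (comap (fun y : V => G.dist x y) atTop) (𝓝 0) := by
  have hpos : ∀ x : V, 0 < G.degree x := fun x =>
    hconn.preconnected.degree_pos_of_nontrivial x
  have hΔ0 : (0 : ℝ) < Δ := by exact_mod_cast (hpos o).trans_le (hΔ o)
  have hρ0 := walkSpectralRadius_pos G hconn hΔ hpos o o'
  have hρ1 := walkSpectralRadius_lt_one G hΔ hpos hna o o'
  set ρ := walkSpectralRadius G o o' with hρ
  refine ⟨mul_pos (by positivity) (sub_pos.2 ((one_lt_div hρ0).2 hρ1)),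
    fun φ x u hu S _ P _ X hX => ?_⟩
  set r : ℝ≥0 := u * (Δ : ℝ≥0) ^ 2 with hr
  -- The threshold condition unfolds to $1+2r<1/\rho$.
  have hlt : ρ < 1 / (1 + 2 * (r : ℝ)) := by
    rw [threshold, div_mul_eq_mul_div, one_mul, lt_div_iff₀ (by positivity)] at hu
    have h1 : 1 + 2 * (r : ℝ) < 1 / ρ := by
      rw [hr]; push_cast; linarith
    rw [lt_div_iff₀ hρ0] at h1
    rw [lt_div_iff₀ (by positivity)]
    linarith
  obtain ⟨q, hq, hq'⟩ := exists_between hlt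
  have hq0 : 0 < q := hρ0.trans hq
  obtain ⟨C, N, hC, hCN⟩ := exists_walkProb_le G hconn hΔ hpos o o' x hq
  set θ : ℝ := (1 + 2 * r) * q
  have hθ0 : 0 ≤ θ := by positivity
  have hθ1 : θ < 1 := by
    rw [lt_div_iff₀ (by positivity)] at hq'
    simp only [θ]; linarith
  set f : ℕ → ℝ≥0∞ := fun n => ENNReal.ofReal (2 * r * C * θ ^ n) with hf
  have hfsum : ∑' n, f n ≠ ∞ := by
    rw [hf, ← ENNReal.ofReal_tsum_of_nonneg (fun n => by positivity)
      ((summable_geometric_of_lt_one hθ0 hθ1).mul_left _)]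
    exact ENNReal.ofReal_ne_top
  have htail := (ENNReal.tendsto_sum_nat_add f hfsum).comp
    (tendsto_comap (f := fun y : V => G.dist x y) (x := atTop))
  refine tendsto_of_tendsto_of_tendsto_of_le_of_le' tendsto_const_nhds htail
    (Eventually.of_forall fun _ => zero_le) ?_
  -- Once $d(x,y)\ge N$, the exponential bound covers every nonzero term of the series.
  filter_upwards [tendsto_comap.eventually (eventually_ge_atTop N)] with y hy
  refine (measure_visits_le φ hΔ hpos hr hX y).trans ?_
  -- Reindex by $n=k+d(x,y)$; the omitted terms vanish because the walk cannot reach `y` in fewer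
  -- than $d(x,y)$ steps.
  rw [← (add_left_injective (G.dist x y)).tsum_eq]
  · refine ENNReal.tsum_le_tsum fun k => ?_
    have h := hCN (k + G.dist x y) (by omega) y
    set n := k + G.dist x y
    have hcoe : (1 + 2 * (r : ℝ≥0∞)) ^ n * (2 * r) =
        ENNReal.ofReal ((1 + 2 * (r : ℝ)) ^ n * (2 * r)) := by
      rw [ENNReal.ofReal_mul (by positivity), ENNReal.ofReal_pow (by positivity),
        ENNReal.ofReal_add zero_le_one (by positivity), ENNReal.ofReal_mul zero_le_two]
      simp
    rw [hcoe, ← ENNReal.ofReal_mul (by positivity)]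
    refine ENNReal.ofReal_le_ofReal ((mul_le_mul_of_nonneg_left h (by positivity)).trans
      (le_of_eq ?_))
    simp only [θ, mul_pow]
    ring
  · intro n hn
    by_contra hlt'
    refine hn ?_
    have hnd : n < G.dist x y := by
      by_contra hge
      exact hlt' ⟨n - G.dist x y, Nat.sub_add_cancel (not_lt.1 hge)⟩
    simp only [walkProb_eq_zero_of_lt_dist G hnd, ENNReal.ofReal_zero, mul_zero]
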